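/- For a binary linear code $C\subseteq\mathbb F_2^n$ write $\dim C$ for its dimension, $d_{\min}(C)$ for its minimum distance and $C^\perp$ for its dual; $C$ is self-dual if $C=C^\perp$, and doubly-even if all its weights are divisible by $4$. For binary linear codes $C_2\subseteq C_1\subseteq\mathbb F_2^n$, $\mathrm{CSS}(C_1,C_2)$ is the space of $n$-qubit states fixed by the Pauli operators $X^x$ ($x\in C_2$) and $Z^z$ ($z\in C_1^\perp$). It has $k=\dim C_1-\dim C_2$ logical qubits and minimum distance $d=\min\{w_H(x): x\in (C_1\setminus C_2)\cup(C_2^\perp\setminus C_1^\perp)\}$. Given $y_1,\dots,y_k\in C_1$ representing a basis of $C_1/C_2$, the encoding is the linear map with $|a\rangle\mapsto|a\rangle_L=|C_2|^{-1/2}\sum_{x\in C_2}|\sum_i a_iy_i+x\rangle$ for $a\in\mathbb F_2^k$. The physical transversal gate $M^{\otimes n}$ realizes the logical transversal gate $N$ if $M^{\otimes n}$ preserves the code space and, for some such $y_1,\dots,y_k$, it sends the encoding of $\varphi$ to the encoding of $N^{\otimes k}\varphi$ for every $\varphi\in(\mathbb C^2)^{\otimes k}$. A sequence of classical or CSS codes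 with length $n_i$, dimension (respectively, number of logical qubits) $k_i$ and minimum distance $d_i$ is asymptotically good if $n_i\to\infty$, $\liminf k_i/n_i>0$ and $\liminf d_i/n_i>0$. Let $R_Z(\theta)=\mathrm{diag}(1,e^{\iota\theta})$ and $S=\mathrm{diag}(1,\iota)$. **Lemma.** For every integer $l\ge1$ there is an asymptotically good sequence of CSS codes in each of which the physical transversal $R_Z(\pi/2^l)$ realizes the logical transversal $S^\dagger$. These codes may be obtained as follows, with $p=l-1$. There are an asymptotically good sequence of self-dual doubly-even codes $C^{(i)}$ and sets $T_i$ of $t_i=\lfloor\tfrac12\min\{\dim C^{(i)},d_{\min}(C^{(i)})\}\rfloor$ coordinates such that the $i$-th CSS code is $\mathrm{CSS}(C_{1},C_{2})$, where $C_1$ is the $2^p$-fold repetition of the code obtained by deleting the coordinates in $T_i$ from all words of $C^{(i)}$, and $C_2$ is the $2^p$-fold repetition of the code obtained by deleting these coordinates from the words of $C^{(i)}$ that vanish on $T_i$. -/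

import Mathlib

noncomputable section

/-! ### Binary linear codes, with coordinates labelled by a finite type -/

/-- A binary linear code with coordinate set `ι`. -/
abbrev BinaryCode (ι : Type) : Type := Submodule (ZMod 2) (ι → ZMod 2)

namespace BinaryCode

/-- The dual code `C^⊥`, for the standard bilinear form. -/
def dual {ι : Type} [Fintype ι] (C : BinaryCode ι) : BinaryCode ι where
  carrier := {z | ∀ x ∈ C, ∑ i, z i * x i = 0}
  add_mem' := by
    intro a b ha hb x hx
    simp only [Pi.add_apply, add_mul, Finset.sum_add_distrib]
    rw [ha x hx, hb x hx, add_zero]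
  zero_mem' := by
    intro x _
    simp
  smul_mem' := by
    intro c a ha x hx
    simp only [Pi.smul_apply, smul_eq_mul, mul_assoc, ← Finset.mul_sum]
    rw [ha x hx, mul_zero]

/-- The dimension of a code. -/
def dim {ι : Type} (C : BinaryCode ι) : ℕ := Module.finrank (ZMod 2) C

/-- The minimum distance: the least Hamming weight of a nonzero codeword
(`0` if there is no nonzero codeword). -/
def minDist {ι : Type} [Fintype ι] (C : BinaryCode ι) : ℕ :=
  sInf {w | ∃ x ∈ C, x ≠ 0 ∧ w = hammingNorm x}

/-- A code is self-dual if it equals its dual. -/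
def IsSelfDual {ι : Type} [Fintype ι] (C : BinaryCode ι) : Prop := C.dual = C

/-- A code is doubly-even if the weight of each codeword is divisible by `4`. -/
def IsDoublyEven {ι : Type} [Fintype ι] (C : BinaryCode ι) : Prop :=
  ∀ x ∈ C, 4 ∣ hammingNorm x

/-- The words that vanish on the coordinates in `T`. -/
def vanishingOn {ι : Type} (T : Finset ι) : BinaryCode ι where
  carrier := {x | ∀ j ∈ T, x j = 0}
  add_mem' := by
    intro a b ha hb j hj
    simp [ha j hj, hb j hj]
  zero_mem' := by
    intro j _
    rfl
  smul_mem' := by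
    intro c a ha j hj
    simp [ha j hj]

/-- The restriction of words to the coordinates outside `T`. -/
def deleteCoords {ι : Type} (T : Finset ι) :
    (ι → ZMod 2) →ₗ[ZMod 2] ({j : ι // j ∉ T} → ZMod 2) :=
  LinearMap.funLeft (ZMod 2) (ZMod 2) Subtype.val

/-- The punctured code: delete the coordinates in `T` from all codewords. -/
def puncture {ι : Type} (C : BinaryCode ι) (T : Finset ι) : BinaryCode {j : ι // j ∉ T} :=
  Submodule.map (deleteCoords T) C

/-- The shortened code: delete the coordinates in `T` from the codewords that vanish on `T`. -/
def shorten {ι : Type} (C : BinaryCode ι) (T : Finset ι) : BinaryCode {j : ι // j ∉ T} :=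
  Submodule.map (deleteCoords T) (C ⊓ vanishingOn T)

/-- The `r`-fold repetition code `{(y, …, y) : y ∈ C}`; the coordinate `(s, j)` is the
coordinate `j` of the copy number `s`. -/
def repetition {ι : Type} (C : BinaryCode ι) (r : ℕ) : BinaryCode (Fin r × ι) :=
  Submodule.map (LinearMap.funLeft (ZMod 2) (ZMod 2) Prod.snd) C

end BinaryCode

/-! ### Operators on qubits

The state space of qubits labelled by `ι` is `(ι → ZMod 2) → ℂ`, with the computational basis
`ket v`, `v : ι → ZMod 2`. -/

/-- The Pauli matrix `X`, with zero diagonal and off-diagonal entries `1`. -/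
def pauliX : Matrix (ZMod 2) (ZMod 2) ℂ :=
  Matrix.of fun v w => if v = w then 0 else 1

/-- The Pauli matrix `Z = diag(1, -1)`. -/
def pauliZ : Matrix (ZMod 2) (ZMod 2) ℂ :=
  Matrix.diagonal fun b => if b = 0 then 1 else -1

/-- The phase gate `S = diag(1, i)`. -/
def gateS : Matrix (ZMod 2) (ZMod 2) ℂ :=
  Matrix.diagonal fun b => if b = 0 then 1 else Complex.I

/-- The rotation `R_Z(θ) = diag(1, exp(iθ))`. -/
def rotZ (θ : ℝ) : Matrix (ZMod 2) (ZMod 2) ℂ :=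
  Matrix.diagonal fun b => if b = 0 then 1 else Complex.exp (Complex.I * (θ : ℂ))

/-- The Kronecker product `⨂ i, M i` of single-qubit matrices. -/
def kron {ι : Type} [Fintype ι] (M : ι → Matrix (ZMod 2) (ZMod 2) ℂ) :
    Matrix (ι → ZMod 2) (ι → ZMod 2) ℂ :=
  Matrix.of fun v w => ∏ i, M i (v i) (w i)

/-- The transversal gate: the same single-qubit matrix on each qubit. -/
def transversal (ι : Type) [Fintype ι] (M : Matrix (ZMod 2) (ZMod 2) ℂ) :
    Matrix (ι → ZMod 2) (ι → ZMod 2) ℂ :=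
  kron fun _ : ι => M

/-- The Pauli operator `E(a, b) = ⨂ i, i^(a_i b_i) X^(a_i) Z^(b_i)`. -/
def pauliE {ι : Type} [Fintype ι] (a b : ι → ZMod 2) :
    Matrix (ι → ZMod 2) (ι → ZMod 2) ℂ :=
  kron fun i => Complex.I ^ ((a i).val * (b i).val) •
    (pauliX ^ (a i).val * pauliZ ^ (b i).val)

/-- The computational basis state `|v⟩`. -/
def ket {ι : Type} [DecidableEq ι] [Fintype ι] (v : ι → ZMod 2) : (ι → ZMod 2) → ℂ :=
  Pi.single v 1

/-! ### CSS codes -/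

/-- The CSS code `CSS(C₁, C₂)` with positively signed stabilizers, on the qubits labelled
by `ι`. -/
structure CSSCode (ι : Type) where
  C₁ : BinaryCode ι
  C₂ : BinaryCode ι
  le : C₂ ≤ C₁

namespace CSSCode

/-- The number of logical qubits. -/
def logicalQubits {ι : Type} (Q : CSSCode ι) : ℕ := Q.C₁.dim - Q.C₂.dim

/-- The minimum distance `min {d_X, d_Z}` (`0` if both sets of words are empty, which happens
only when there are no logical qubits). -/
def minDist {ι : Type} [Fintype ι] (Q : CSSCode ι) : ℕ :=
  sInf {w | ∃ x : ι → ZMod 2,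
    ((x ∈ Q.C₁ ∧ x ∉ Q.C₂) ∨ (x ∈ Q.C₂.dual ∧ x ∉ Q.C₁.dual)) ∧ w = hammingNorm x}

/-- The code space: the states fixed by the `X`-stabilizers `E(x, 0)`, `x ∈ C₂`, and by the
`Z`-stabilizers `E(0, z)`, `z ∈ C₁^⊥`. -/
def codeSpace {ι : Type} [Fintype ι] [DecidableEq ι] (Q : CSSCode ι) :
    Set ((ι → ZMod 2) → ℂ) :=
  {ψ | (∀ x ∈ Q.C₂, (pauliE x 0).mulVec ψ = ψ) ∧
    ∀ z ∈ Q.C₁.dual, (pauliE 0 z).mulVec ψ = ψ}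

/-- `y` is a system of representatives in `C₁` of a basis of the coset space `C₁ / C₂`. -/
def IsLogicalBasis {ι : Type} (Q : CSSCode ι) (y : Fin Q.logicalQubits → ι → ZMod 2) : Prop :=
  (∀ i, y i ∈ Q.C₁) ∧ LinearIndependent (ZMod 2) (fun i => Q.C₂.mkQ (y i)) ∧
    Submodule.span (ZMod 2) (Set.range y) ⊔ Q.C₂ = Q.C₁

open Classical in
/-- The encoded basis state
`|a⟩_L = |C₂|^(-1/2) ∑_{x ∈ C₂} |y_a + x⟩`, where `y_a = ∑ i, a_i y_i`. -/
def logicalKet {ι : Type} [Fintype ι] [DecidableEq ι] (Q : CSSCode ι)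
    (y : Fin Q.logicalQubits → ι → ZMod 2) (a : Fin Q.logicalQubits → ZMod 2) :
    (ι → ZMod 2) → ℂ :=
  ((1 / Real.sqrt (Nat.card Q.C₂ : ℝ) : ℝ) : ℂ) •
    ∑ x : ι → ZMod 2 with x ∈ Q.C₂, ket ((∑ i, a i • y i) + x)

/-- The encoding map: the linear extension of `|a⟩ ↦ |a⟩_L`. -/
def encode {ι : Type} [Fintype ι] [DecidableEq ι] (Q : CSSCode ι)
    (y : Fin Q.logicalQubits → ι → ZMod 2) (φ : (Fin Q.logicalQubits → ZMod 2) → ℂ) :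
    (ι → ZMod 2) → ℂ :=
  ∑ a, φ a • Q.logicalKet y a

/-- The physical transversal gate `M` realizes the logical transversal gate `N`: it preserves
the code space, and for some choice of the logical qubits (a basis of `C₁ / C₂`) it acts on the
encoded states as `N` applied to each logical qubit. -/
def RealizesTransversal {ι : Type} [Fintype ι] [DecidableEq ι] (Q : CSSCode ι)
    (M N : Matrix (ZMod 2) (ZMod 2) ℂ) : Prop :=
  (∀ ψ ∈ Q.codeSpace, (transversal ι M).mulVec ψ ∈ Q.codeSpace) ∧
    ∃ y : Fin Q.logicalQubits → ι → ZMod 2, Q.IsLogicalBasis y ∧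
      ∀ φ : (Fin Q.logicalQubits → ZMod 2) → ℂ,
        (transversal ι M).mulVec (Q.encode y φ) =
          Q.encode y ((transversal (Fin Q.logicalQubits) N).mulVec φ)

/-- The CSS code of a binary code `C`, a set `T` of coordinates and `p ≥ 0`: `C₁` is `C`
punctured at `T`, `C₂` is `C` shortened at `T`, and both are then repeated `2^p` times.
If `C` has a generator matrix in systematic form and `T` is the set of the first `t`
coordinates, with `t ≤ dim C`, then the shortened code is generated by the rows of the
punctured matrix other than the first `t`. -/
def ofPuncture {ι : Type} (C : BinaryCode ι) (T : Finset ι) (p : ℕ) :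
    CSSCode (Fin (2 ^ p) × {j : ι // j ∉ T}) where
  C₁ := (C.puncture T).repetition (2 ^ p)
  C₂ := (C.shorten T).repetition (2 ^ p)
  le := Submodule.map_mono (Submodule.map_mono inf_le_left)

end CSSCode

/-! ### Asymptotically good families -/

/-- Parameters `(n_i, k_i, d_i)` with `n_i → ∞`, `liminf k_i / n_i > 0` and
`liminf d_i / n_i > 0`. (For parameters of codes the quotients lie in `[0, 1]`.) -/
def AsymptoticallyGoodParams (n k d : ℕ → ℕ) : Prop :=
  Filter.Tendsto n Filter.atTop Filter.atTop ∧
    0 < Filter.liminf (fun i => (k i : ℝ) / (n i : ℝ)) Filter.atTop ∧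
    0 < Filter.liminf (fun i => (d i : ℝ) / (n i : ℝ)) Filter.atTop

/-- An asymptotically good sequence of binary linear codes. -/
def BinaryCode.AsymptoticallyGood {ι : ℕ → Type} [∀ i, Fintype (ι i)]
    (C : ∀ i, BinaryCode (ι i)) : Prop :=
  AsymptoticallyGoodParams (fun i => Fintype.card (ι i)) (fun i => (C i).dim)
    (fun i => (C i).minDist)

/-- An asymptotically good sequence of CSS codes. -/
def CSSCode.AsymptoticallyGood {ι : ℕ → Type} [∀ i, Fintype (ι i)]
    (Q : ∀ i, CSSCode (ι i)) : Prop :=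
  AsymptoticallyGoodParams (fun i => Fintype.card (ι i)) (fun i => (Q i).logicalQubits)
    (fun i => (Q i).minDist)

end

/-! Gate action. For a word `x` of a doubly-even code, the weights on and off `T` add up to a
multiple of 4. Repeating `2^(l-1)` times turns the phase exp(iπ/2^l) per qubit into a factor i per
nonzero coordinate off `T`, so `x` acquires i^(weight off `T`) = (-i)^(weight on `T`); this is
`rotZ_phase_spread`. Since `C₂` comes from the words vanishing on `T`, a coset of `C₂` in `C₁` is
labelled by the restriction of `x` to `T`, and the phase is that of S† on every bit of the label.

Parameters. Let `C` be self-dual with minimum distance d > |T|. A word supported on `T` and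
orthogonal to `C` lies in `C`, hence is zero; so `C` restricts onto all words on `T`
(`IsSelfDual.exists_systematic`), and there are exactly |T| logical qubits. Deleting `T` costs at
most |T| in weight, which bounds the X-distance. For the Z-distance, the column sums of a word of
`C₂.dual` agree off `T` with a word of `C.dual = C`. Hence the distance is at least d - |T|, and
taking |T| to be half of min(dim, d) keeps both parameters linear.

Good self-dual doubly-even codes. If 4 divides the length, half the weight modulo 2 is a quadratic
form on the even words modulo the all-ones word. Totally singular subspaces of half dimension give
self-dual doubly-even codes; those complementary to the span of the `d i` are graphs, parametrized
by alternating matrices `M + Mᵀ`. A word pairing nontrivially with some `d i` lies in only a small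
fraction of these codes (`card_mem_code_mul_le`), so a union bound over the words of low weight
leaves a code of large distance. -/

namespace BinaryCode

/-! ### Weights modulo 4, duality and a ball estimate -/

theorem mem_dual {ι : Type} [Fintype ι] {C : BinaryCode ι} {z : ι → ZMod 2} :
    z ∈ C.dual ↔ ∀ x ∈ C, z ⬝ᵥ x = 0 := Iff.rfl

theorem natCast_hammingNorm {ι R : Type} [Fintype ι] [CommSemiring R] (x : ι → ZMod 2) :
    (hammingNorm x : R) = ∑ i, ((x i).val : R) := by
  rw [hammingNorm, Finset.card_filter, Nat.cast_sum]
  refine Finset.sum_congr rfl fun i _ => ?_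
  have key : ∀ a : ZMod 2, (if a ≠ 0 then 1 else 0) = a.val := by decide
  rw [key]

theorem hammingNorm_eq_sum_val {ι : Type} [Fintype ι] (x : ι → ZMod 2) :
    hammingNorm x = ∑ i, (x i).val := by
  simpa using natCast_hammingNorm (R := ℕ) x

/-- Inclusion-exclusion subtracts twice the overlap of the supports. Modulo 4 only the parity of the
overlap, the dot product, matters, and -2 = 2. This is the polarization identity behind all
doubly-even arguments. -/
theorem hammingNorm_add_zmod_four {ι : Type} [Fintype ι] (x y : ι → ZMod 2) :
    (hammingNorm (x + y) : ZMod 4) =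
      hammingNorm x + hammingNorm y + 2 * ((x ⬝ᵥ y).val : ZMod 4) := by
  -- Doubling is additive from ℤ/2 to ℤ/4, so the identity can be checked coordinatewise.
  let f : ZMod 2 →+ ZMod 4 := AddMonoidHom.mk' (fun a => 2 * (a.val : ZMod 4)) (by decide)
  have h : 2 * ((x ⬝ᵥ y).val : ZMod 4) = ∑ i, f (x i * y i) := by
    rw [← map_sum]; rfl
  rw [h, natCast_hammingNorm, natCast_hammingNorm, natCast_hammingNorm,
    ← Finset.sum_add_distrib, ← Finset.sum_add_distrib]
  refine Finset.sum_congr rfl fun i _ => ?_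
  have key : ∀ a b : ZMod 2, ((a + b).val : ZMod 4) = a.val + b.val + f (a * b) := by
    change ∀ a b : ZMod 2, ((a + b).val : ZMod 4) = a.val + b.val + 2 * ((a * b).val : ZMod 4)
    decide
  exact key _ _

theorem four_dvd_iff {m : ℕ} : 4 ∣ m ↔ (m : ZMod 4) = 0 :=
  (ZMod.natCast_eq_zero_iff m 4).symm

theorem dotProduct_one_eq {ι : Type} [Fintype ι] (x : ι → ZMod 2) :
    x ⬝ᵥ 1 = (hammingNorm x : ZMod 2) := by
  rw [natCast_hammingNorm, dotProduct_one]
  simp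

theorem hammingNorm_one {ι : Type} [Fintype ι] :
    hammingNorm (1 : ι → ZMod 2) = Fintype.card ι := by
  simp [hammingNorm]

theorem IsDoublyEven.le_dual {ι : Type} [Fintype ι] {C : BinaryCode ι} (h : C.IsDoublyEven) :
    C ≤ C.dual := by
  intro x hx
  rw [mem_dual]
  intro y hy
  have e := hammingNorm_add_zmod_four x y
  rw [four_dvd_iff.1 (h _ (C.add_mem hx hy)), four_dvd_iff.1 (h _ hx),
    four_dvd_iff.1 (h _ hy)] at e
  have key : ∀ a : ZMod 2, (0 : ZMod 4) = 0 + 0 + 2 * (a.val : ZMod 4) → a = 0 := by decide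
  exact key _ e

theorem span_le_dual_span {ι : Type} [Fintype ι] {S : Set (ι → ZMod 2)}
    (h : ∀ x ∈ S, ∀ y ∈ S, x ⬝ᵥ y = 0) :
    Submodule.span (ZMod 2) S ≤ BinaryCode.dual (Submodule.span (ZMod 2) S) := by
  have h1 : ∀ x ∈ S, ∀ y ∈ Submodule.span (ZMod 2) S, x ⬝ᵥ y = 0 := by
    intro x hx y hy
    induction hy using Submodule.span_induction with
    | mem y hy => exact h x hx y hy
    | zero => simp
    | add a b _ _ ha hb => rw [dotProduct_add, ha, hb, add_zero]
    | smul c a _ ha => rw [dotProduct_smul, ha, smul_zero]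
  exact Submodule.span_le.2 fun x hx => mem_dual.2 (h1 x hx)

theorem isDoublyEven_span {ι : Type} [Fintype ι] {S : Set (ι → ZMod 2)}
    (h : ∀ x ∈ S, ∀ y ∈ S, x ⬝ᵥ y = 0) (hw : ∀ x ∈ S, 4 ∣ hammingNorm x) :
    BinaryCode.IsDoublyEven (Submodule.span (ZMod 2) S) := by
  intro x hx
  induction hx using Submodule.span_induction with
  | mem x hx => exact hw x hx
  | zero => simp
  | add a b ha hb iha ihb =>
    rw [four_dvd_iff] at *
    rw [hammingNorm_add_zmod_four, iha, ihb, mem_dual.1 (span_le_dual_span h ha) b hb]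
    simp
  | smul c a _ ha =>
    have key : ∀ c : ZMod 2, c = 0 ∨ c = 1 := by decide
    rcases key c with rfl | rfl
    · simp
    · simpa using ha

theorem dual_eq_orthogonal {ι : Type} [Fintype ι] [DecidableEq ι] (C : BinaryCode ι) :
    C.dual = (Matrix.toBilin' (1 : Matrix ι ι (ZMod 2))).orthogonal C := by
  ext z
  rw [mem_dual, LinearMap.BilinForm.mem_orthogonal_iff]
  refine forall₂_congr fun x _ => ?_
  rw [Matrix.toBilin'_apply', Matrix.one_mulVec, dotProduct_comm]

theorem nondegenerate_toBilin'_one {ι : Type} [Fintype ι] [DecidableEq ι] :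
    (Matrix.toBilin' (1 : Matrix ι ι (ZMod 2))).Nondegenerate :=
  LinearMap.BilinForm.nondegenerate_toBilin'_of_det_ne_zero' _ (by simp)

theorem isRefl_toBilin'_one {ι : Type} [Fintype ι] [DecidableEq ι] :
    (Matrix.toBilin' (1 : Matrix ι ι (ZMod 2))).IsRefl := by
  intro x y h
  rw [Matrix.toBilin'_apply', Matrix.one_mulVec] at *
  rw [dotProduct_comm, h]

theorem dim_dual {ι : Type} [Fintype ι] (C : BinaryCode ι) :
    C.dual.dim = Fintype.card ι - C.dim := by
  classical
  rw [dual_eq_orthogonal, dim, LinearMap.BilinForm.finrank_orthogonal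
    nondegenerate_toBilin'_one, Module.finrank_fintype_fun_eq_card, dim]

theorem dual_dual {ι : Type} [Fintype ι] (C : BinaryCode ι) : C.dual.dual = C := by
  classical
  rw [dual_eq_orthogonal, dual_eq_orthogonal, LinearMap.BilinForm.orthogonal_orthogonal
    nondegenerate_toBilin'_one isRefl_toBilin'_one]

theorem IsDoublyEven.isSelfDual {ι : Type} [Fintype ι] {C : BinaryCode ι} (h : C.IsDoublyEven)
    (hd : 2 * C.dim = Fintype.card ι) : C.IsSelfDual := by
  refine (Submodule.eq_of_le_of_finrank_eq h.le_dual ?_).symm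
  have := dim_dual C
  change C.dim = C.dual.dim
  omega

theorem le_minDist {ι : Type} [Fintype ι] {C : BinaryCode ι} {w : ℕ} (hC : C ≠ ⊥)
    (h : ∀ x ∈ C, x ≠ 0 → w ≤ hammingNorm x) : w ≤ C.minDist := by
  obtain ⟨x, hx, hx0⟩ := Submodule.exists_mem_ne_zero_of_ne_bot hC
  refine le_csInf ⟨_, x, hx, hx0, rfl⟩ ?_
  rintro _ ⟨y, hy, hy0, rfl⟩
  exact h y hy hy0

theorem minDist_le {ι : Type} [Fintype ι] {C : BinaryCode ι} {x : ι → ZMod 2} (hx : x ∈ C)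
    (hx0 : x ≠ 0) : C.minDist ≤ hammingNorm x :=
  Nat.sInf_le ⟨x, hx, hx0, rfl⟩

/-- Chernoff-type bound: giving each word the mass 4^(number of zeros) makes the total mass 5^n, and
each word of weight at most `w` has mass at least 4^(n-w). -/
theorem card_hammingNorm_le_mul {ι : Type} [Fintype ι] [DecidableEq ι] {w : ℕ}
    (hw : w ≤ Fintype.card ι) :
    (Finset.univ.filter fun v : ι → ZMod 2 => hammingNorm v ≤ w).card *
      4 ^ (Fintype.card ι - w) ≤ 5 ^ Fintype.card ι := by
  have key : ∑ v : ι → ZMod 2, ∏ i, (if v i = 0 then 4 else 1) = 5 ^ Fintype.card ι := by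
    rw [← Fintype.prod_sum (fun (_ : ι) (a : ZMod 2) => if a = 0 then 4 else 1)]
    have : ∑ a : ZMod 2, (if a = 0 then 4 else 1) = 5 := by decide
    simp [this]
  rw [← key, ← smul_eq_mul, ← Finset.sum_const]
  refine (Finset.sum_le_sum fun v hv => ?_).trans
    (Finset.sum_le_sum_of_subset (Finset.filter_subset _ _))
  rw [Finset.prod_ite, Finset.prod_const, Finset.prod_const_one, mul_one]
  refine Nat.pow_le_pow_right (by norm_num) ?_
  have h1 := Finset.card_filter_add_card_filter_not (s := Finset.univ) (fun i => v i = 0)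
  have h2 : hammingNorm v ≤ w := (Finset.mem_filter.1 hv).2
  rw [hammingNorm] at h2
  rw [Finset.card_univ] at h1
  have h3 : (Finset.univ.filter fun i => ¬ v i = 0).card =
    (Finset.univ.filter fun i => v i ≠ 0).card := rfl
  omega

end BinaryCode

/-! ### A family of self-dual doubly-even codes indexed by matrices -/

/-- Dual systems `d i`, `g i` of even words: the `d i` span a doubly-even code, and the `g i`
have weight `2` modulo `4`. -/
structure HyperbolicFrame (ι κ : Type) [Fintype ι] [DecidableEq κ] where
  d : κ → ι → ZMod 2
  g : κ → ι → ZMod 2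
  four_dvd_d : ∀ i, 4 ∣ hammingNorm (d i)
  d_dot_d : ∀ i j, d i ⬝ᵥ d j = 0
  d_dot_g : ∀ i j, d i ⬝ᵥ g j = if i = j then 1 else 0
  g_weight : ∀ i, (hammingNorm (g i) : ZMod 4) = 2

namespace HyperbolicFrame

variable {ι κ : Type} [Fintype ι] [LinearOrder κ] (F : HyperbolicFrame ι κ)

/-- Relabelling the coordinates of a frame. -/
def reindex {ι' : Type} [Fintype ι'] (e : ι' ≃ ι) : HyperbolicFrame ι' κ where
  d i := F.d i ∘ e
  g i := F.g i ∘ e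
  four_dvd_d i := by
    rw [BinaryCode.four_dvd_iff, BinaryCode.natCast_hammingNorm,
      ← BinaryCode.four_dvd_iff.1 (F.four_dvd_d i), BinaryCode.natCast_hammingNorm]
    exact e.sum_comp fun a => ((F.d i a).val : ZMod 4)
  d_dot_d i j := (comp_equiv_dotProduct_comp_equiv _ _ e).trans (F.d_dot_d i j)
  d_dot_g i j := (comp_equiv_dotProduct_comp_equiv _ _ e).trans (F.d_dot_g i j)
  g_weight i := by
    rw [BinaryCode.natCast_hammingNorm, ← F.g_weight i, BinaryCode.natCast_hammingNorm]
    exact e.sum_comp fun a => ((F.g i a).val : ZMod 4)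

/-- The matrix of corrections which makes the words `g i + ∑ j, A i j • d j` orthogonal and
doubly-even, shifted by the alternating matrix `M + Mᵀ`. -/
def correction (M : κ → κ → ZMod 2) (i j : κ) : ZMod 2 :=
  (if i = j then 1 else if i < j then F.g i ⬝ᵥ F.g j else 0) + (M i j + M j i)

theorem one_dot_d (i : κ) : 1 ⬝ᵥ F.d i = 0 := by
  rw [dotProduct_comm, BinaryCode.dotProduct_one_eq, ZMod.natCast_eq_zero_iff]
  exact (by norm_num : 2 ∣ 4).trans (F.four_dvd_d i)

theorem one_dot_g (i : κ) : 1 ⬝ᵥ F.g i = 0 := by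
  rw [dotProduct_comm, BinaryCode.dotProduct_one_eq]
  have h := congrArg (ZMod.castHom (by norm_num : 2 ∣ 4) (ZMod 2)) (F.g_weight i)
  rw [map_natCast] at h
  rw [h]
  decide

theorem correction_self (M : κ → κ → ZMod 2) (i : κ) : F.correction M i i = 1 := by
  simp [correction, CharTwo.add_self_eq_zero]

/-- This is the condition for distinct generators to be orthogonal. The order on `κ` only decides
which of the two entries carries `g i ⬝ᵥ g j`; the symmetric term cancels in characteristic 2. -/
theorem correction_add_correction (M : κ → κ → ZMod 2) {i j : κ} (h : i ≠ j) :
    F.correction M i j + F.correction M j i = F.g i ⬝ᵥ F.g j := by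
  have h2 : M i j + M j i + (M j i + M i j) = 0 := by
    rw [add_comm (M j i), CharTwo.add_self_eq_zero]
  rcases lt_or_gt_of_ne h with hl | hl
  · simp only [correction, if_neg h, if_neg h.symm, if_pos hl, if_neg hl.not_gt]
    linear_combination h2
  · simp only [correction, if_neg h, if_neg h.symm, if_pos hl, if_neg hl.not_gt]
    rw [dotProduct_comm]
    linear_combination h2

variable [Fintype κ]

/-- The generators of the twisted code: the all-ones word and the corrected words `g i`. -/
def generator (M : κ → κ → ZMod 2) : Option κ → ι → ZMod 2
  | none => 1
  | some i => F.g i + ∑ j, F.correction M i j • F.d j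

/-- The code spanned by the all-ones word and the corrected words `g i`. -/
def code (M : κ → κ → ZMod 2) : BinaryCode ι :=
  Submodule.span (ZMod 2) (Set.range (F.generator M))

theorem sum_dot_d (c : κ → ZMod 2) (l : κ) : (∑ j, c j • F.d j) ⬝ᵥ F.d l = 0 := by
  simp [sum_dotProduct, smul_dotProduct, F.d_dot_d]

theorem sum_dot_g (c : κ → ZMod 2) (l : κ) : (∑ j, c j • F.d j) ⬝ᵥ F.g l = c l := by
  simp [sum_dotProduct, smul_dotProduct, F.d_dot_g]

theorem sum_dot_sum (b c : κ → ZMod 2) :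
    (∑ j, b j • F.d j) ⬝ᵥ (∑ j, c j • F.d j) = 0 := by
  rw [dotProduct_sum]
  exact Finset.sum_eq_zero fun j _ => by rw [dotProduct_smul, sum_dot_d, smul_zero]

theorem four_dvd_sum (c : κ → ZMod 2) : 4 ∣ hammingNorm (∑ j, c j • F.d j) := by
  have h : BinaryCode.IsDoublyEven (Submodule.span (ZMod 2) (Set.range F.d)) := by
    refine BinaryCode.isDoublyEven_span ?_ ?_
    · rintro _ ⟨i, rfl⟩ _ ⟨j, rfl⟩
      exact F.d_dot_d i j
    · rintro _ ⟨i, rfl⟩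
      exact F.four_dvd_d i
  exact h _ (Submodule.sum_mem _ fun j _ =>
    Submodule.smul_mem _ _ (Submodule.subset_span ⟨j, rfl⟩))

variable (M : κ → κ → ZMod 2)

theorem generator_dot_d (i l : κ) :
    F.generator M (some i) ⬝ᵥ F.d l = if i = l then 1 else 0 := by
  rw [generator, add_dotProduct, sum_dot_d, add_zero, dotProduct_comm, F.d_dot_g]
  simp only [eq_comm]

theorem generator_dot_g (i l : κ) :
    F.generator M (some i) ⬝ᵥ F.g l = F.g i ⬝ᵥ F.g l + F.correction M i l := by
  rw [generator, add_dotProduct, sum_dot_g]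

theorem one_dot_generator (i : κ) : 1 ⬝ᵥ F.generator M (some i) = 0 := by
  rw [generator, dotProduct_add, one_dot_g, dotProduct_sum, zero_add]
  exact Finset.sum_eq_zero fun j _ => by rw [dotProduct_smul, one_dot_d, smul_zero]

/-- The diagonal correction 1 makes the overlap of `g i` with its correcting sum odd, which
contributes 2 modulo 4 and cancels the weight 2 of `g i`. -/
theorem four_dvd_generator (i : κ) : 4 ∣ hammingNorm (F.generator M (some i)) := by
  rw [BinaryCode.four_dvd_iff, generator, BinaryCode.hammingNorm_add_zmod_four, F.g_weight,
    BinaryCode.four_dvd_iff.1 (F.four_dvd_sum _), dotProduct_comm, sum_dot_g, correction_self]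
  decide

theorem generator_dot_generator {i j : κ} (h : i ≠ j) :
    F.generator M (some i) ⬝ᵥ F.generator M (some j) = 0 := by
  rw [generator, generator, add_dotProduct, dotProduct_add, dotProduct_add, sum_dot_sum,
    sum_dot_g, dotProduct_comm (F.g i) (∑ _, _), sum_dot_g, add_zero, add_assoc,
    add_comm (F.correction M j i), F.correction_add_correction M h, CharTwo.add_self_eq_zero]

theorem isDoublyEven_code (hι : 4 ∣ Fintype.card ι) : (F.code M).IsDoublyEven := by
  have hw : ∀ i, 4 ∣ hammingNorm (F.generator M i) := by
    rintro (_ | i)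
    · rw [generator, BinaryCode.hammingNorm_one]
      exact hι
    · exact F.four_dvd_generator M i
  have hself : ∀ x : ι → ZMod 2, 4 ∣ hammingNorm x → x ⬝ᵥ x = 0 := by
    intro x hx
    have h : x ⬝ᵥ x = x ⬝ᵥ 1 := by
      refine Finset.sum_congr rfl fun i _ => ?_
      have key : ∀ a : ZMod 2, a * a = a * 1 := by decide
      exact key _
    rw [h, BinaryCode.dotProduct_one_eq, ZMod.natCast_eq_zero_iff]
    exact (by norm_num : 2 ∣ 4).trans hx
  refine BinaryCode.isDoublyEven_span ?_ ?_
  · rintro _ ⟨i, rfl⟩ _ ⟨j, rfl⟩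
    by_cases hij : i = j
    · subst hij
      exact hself _ (hw i)
    · rcases i with _ | i <;> rcases j with _ | j
      · exact absurd rfl hij
      · exact F.one_dot_generator M j
      · rw [dotProduct_comm]
        exact F.one_dot_generator M i
      · exact F.generator_dot_generator M fun h => hij (congrArg some h)
  · rintro _ ⟨i, rfl⟩
    exact hw i

theorem sum_generator_dot_d (c : Option κ → ZMod 2) (l : κ) :
    (∑ i, c i • F.generator M i) ⬝ᵥ F.d l = c (some l) := by
  rw [Fintype.sum_option, add_dotProduct, smul_dotProduct, generator, one_dot_d, smul_zero,
    zero_add, sum_dotProduct]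
  simp [smul_dotProduct, generator_dot_d]

theorem linearIndependent_generator [Nonempty ι] :
    LinearIndependent (ZMod 2) (F.generator M) := by
  rw [Fintype.linearIndependent_iff]
  intro c hc
  have h : ∀ l, c (some l) = 0 := fun l => by
    rw [← F.sum_generator_dot_d M c l, hc, zero_dotProduct]
  rintro (_ | l)
  · rw [Fintype.sum_option] at hc
    simp only [h, zero_smul, Finset.sum_const_zero, add_zero, generator] at hc
    have := congrFun hc (Classical.arbitrary ι)
    simpa using this
  · exact h l

theorem dim_code [Nonempty ι] : (F.code M).dim = Fintype.card κ + 1 := by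
  rw [BinaryCode.dim, code, finrank_span_eq_card (F.linearIndependent_generator M),
    Fintype.card_option]

theorem isSelfDual_code (hι : 4 ∣ Fintype.card ι)
    (hκ : 2 * (Fintype.card κ + 1) = Fintype.card ι) : (F.code M).IsSelfDual := by
  have : Nonempty ι := Fintype.card_pos_iff.1 (by omega)
  exact (F.isDoublyEven_code M hι).isSelfDual (by rw [dim_code, hκ])

variable {M}

/-- Pairing with `d i` reads off the coefficient of the `i`-th generator, so only the all-ones
generator can survive. -/
theorem eq_zero_or_one_of_mem_code {v : ι → ZMod 2} (hv : v ∈ F.code M)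
    (h : ∀ i, v ⬝ᵥ F.d i = 0) : v = 0 ∨ v = 1 := by
  obtain ⟨c, rfl⟩ := (Submodule.mem_span_range_iff_exists_fun _).1 hv
  simp only [sum_generator_dot_d] at h
  rw [Fintype.sum_option]
  simp only [h, zero_smul, Finset.sum_const_zero, add_zero, generator]
  have key : ∀ a : ZMod 2, a = 0 ∨ a = 1 := by decide
  rcases key (c none) with hc | hc <;> simp [hc]

/-- The coefficients of `v` do not depend on `M`, so membership imposes equations on `M` that are
affine, one for each `l`. -/
theorem dot_g_of_mem_code {v : ι → ZMod 2} (hv : v ∈ F.code M) (l : κ) :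
    v ⬝ᵥ F.g l = ∑ i, (v ⬝ᵥ F.d i) * (F.g i ⬝ᵥ F.g l + F.correction M i l) := by
  obtain ⟨c, rfl⟩ := (Submodule.mem_span_range_iff_exists_fun _).1 hv
  simp only [sum_generator_dot_d]
  rw [Fintype.sum_option, add_dotProduct, smul_dotProduct, generator, one_dot_g, smul_zero,
    zero_add, sum_dotProduct]
  simp [smul_dotProduct, generator_dot_g]

open Classical in
-- The equations from `dot_g_of_mem_code` with `l ≠ i₀` are independent, as a change of the row `i₀`
-- of `M` shifts them arbitrarily. Thus the solutions have that many disjoint translates. The index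
-- `i₀` is lost because `M + Mᵀ` has zero diagonal.
theorem card_mem_code_mul_le {v : ι → ZMod 2} {i₀ : κ} (hv : v ⬝ᵥ F.d i₀ ≠ 0) :
    (Finset.univ.filter fun M => v ∈ F.code M).card * 2 ^ (Fintype.card κ - 1) ≤
      Fintype.card (κ → κ → ZMod 2) := by
  have hcard : 2 ^ (Fintype.card κ - 1) = Fintype.card ({j // j ≠ i₀} → ZMod 2) := by
    rw [Fintype.card_fun, ZMod.card, Fintype.card_subtype_compl, Fintype.card_subtype_eq]
  -- `Y y` is supported on row `i₀`; adding it to `M` shifts the `l`-th equation by exactly `y l`.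
  let Y (y : {j // j ≠ i₀} → ZMod 2) : κ → κ → ZMod 2 := fun i j =>
    if i = i₀ then (if h : j ≠ i₀ then y ⟨j, h⟩ else 0) else 0
  have hY : ∀ y (l : {j // j ≠ i₀}),
      ∑ i, (v ⬝ᵥ F.d i) * (Y y i l + Y y l i) = y l := by
    intro y l
    have h1 : v ⬝ᵥ F.d i₀ = 1 := by
      have key : ∀ a : ZMod 2, a ≠ 0 → a = 1 := by decide
      exact key _ hv
    have h2 : ∀ i, (v ⬝ᵥ F.d i) * (Y y i l + Y y l i) = if i = i₀ then y l else 0 := by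
      intro i
      simp only [Y, if_neg l.2, dif_pos l.2, add_zero]
      split_ifs with h
      · rw [h, h1, one_mul]
      · rw [mul_zero]
    rw [Finset.sum_congr rfl fun i _ => h2 i]
    simp
  rw [hcard, ← Fintype.card_subtype, ← Fintype.card_prod]
  refine Fintype.card_le_of_injective
    (fun p : {M // v ∈ F.code M} × ({j // j ≠ i₀} → ZMod 2) => p.1.1 + Y p.2) ?_
  rintro ⟨⟨M, hM⟩, y⟩ ⟨⟨M', hM'⟩, y'⟩ h
  have h : ∀ i j, M i j + Y y i j = M' i j + Y y' i j := fun i j =>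
    congrFun (congrFun h i) j
  have hy : y = y' := by
    -- Both matrices satisfy the equation for `l`, so the shifts `y l` and `y' l` must agree.
    ext l
    have e := (F.dot_g_of_mem_code hM l).symm.trans (F.dot_g_of_mem_code hM' l)
    rw [← sub_eq_zero, ← Finset.sum_sub_distrib] at e
    rw [← sub_eq_zero, ← hY y, ← hY y', ← Finset.sum_sub_distrib, ← neg_eq_zero, ← e,
      ← Finset.sum_neg_distrib]
    refine Finset.sum_congr rfl fun i _ => ?_
    rw [correction, correction]
    linear_combination (-(v ⬝ᵥ F.d i)) * (h i l + h l i)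
  subst hy
  simp only [Prod.mk.injEq, Subtype.mk.injEq, and_true]
  ext i j
  exact add_right_cancel (h i j)

/-- Union bound: if every `M` were bad, the sets of matrices attached to the low-weight words would
cover all matrices, against the count. -/
theorem exists_code_weight_gt [DecidableEq ι] {w : ℕ} (hw : w < Fintype.card ι)
    (hcount : (Finset.univ.filter fun v : ι → ZMod 2 => hammingNorm v ≤ w).card <
      2 ^ (Fintype.card κ - 1)) :
    ∃ M, ∀ v ∈ F.code M, v ≠ 0 → w < hammingNorm v := by
  classical
  by_contra! hcon
  set B := Finset.univ.filter fun v : ι → ZMod 2 => hammingNorm v ≤ w with hB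
  -- Words orthogonal to every `d i` may be dropped: in a code they are 0 or all-ones, and the
  -- latter has weight above `w`.
  let B' := B.filter fun v => ∃ i, v ⬝ᵥ F.d i ≠ 0
  have hcover : (Finset.univ : Finset (κ → κ → ZMod 2)) ⊆
      B'.biUnion fun v => Finset.univ.filter fun M => v ∈ F.code M := by
    intro M _
    obtain ⟨v, hv, hv0, hvw⟩ := hcon M
    refine Finset.mem_biUnion.2 ⟨v, ?_, by simpa using hv⟩
    refine Finset.mem_filter.2 ⟨by simpa [hB] using hvw, ?_⟩
    by_contra! h
    rcases F.eq_zero_or_one_of_mem_code hv h with rfl | rfl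
    · exact hv0 rfl
    · rw [BinaryCode.hammingNorm_one] at hvw
      omega
  have h1 := (Finset.card_le_card hcover).trans Finset.card_biUnion_le
  have h2 : Fintype.card (κ → κ → ZMod 2) * 2 ^ (Fintype.card κ - 1) ≤
      B.card * Fintype.card (κ → κ → ZMod 2) := by
    calc _ ≤ (∑ v ∈ B', (Finset.univ.filter fun M => v ∈ F.code M).card) *
          2 ^ (Fintype.card κ - 1) := Nat.mul_le_mul_right _ h1
      _ ≤ ∑ v ∈ B', Fintype.card (κ → κ → ZMod 2) := by
          rw [Finset.sum_mul]
          refine Finset.sum_le_sum fun v hv => ?_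
          obtain ⟨i, hi⟩ := (Finset.mem_filter.1 hv).2
          exact F.card_mem_code_mul_le hi
      _ ≤ _ := by
          rw [Finset.sum_const, smul_eq_mul]
          exact Nat.mul_le_mul_right _ (Finset.card_filter_le _ _)
  have h3 : 0 < Fintype.card (κ → κ → ZMod 2) := Fintype.card_pos
  rw [mul_comm] at h2
  exact absurd (Nat.le_of_mul_le_mul_right h2 h3) (by omega)

end HyperbolicFrame

/-! ### An explicit frame -/

namespace BinaryCode

theorem hammingNorm_sum_elim {α β : Type} [Fintype α] [Fintype β] (a : α → ZMod 2)
    (b : β → ZMod 2) : hammingNorm (Sum.elim a b) = hammingNorm a + hammingNorm b := by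
  rw [hammingNorm_eq_sum_val, hammingNorm_eq_sum_val, hammingNorm_eq_sum_val]
  exact Fintype.sum_sum_type _

theorem hammingNorm_single {α : Type} [Fintype α] [DecidableEq α] (i : α) :
    hammingNorm (Pi.single i 1 : α → ZMod 2) = 1 := by
  rw [hammingNorm, Finset.card_eq_one]
  refine ⟨i, ?_⟩
  ext j
  by_cases h : j = i <;> simp [Pi.single_apply, h]

theorem hammingNorm_single_add_single {α : Type} [Fintype α] [DecidableEq α] {i j : α}
    (h : i ≠ j) : (hammingNorm (Pi.single i 1 + Pi.single j 1 : α → ZMod 2) : ZMod 4) = 2 := by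
  rw [hammingNorm_add_zmod_four, hammingNorm_single, hammingNorm_single, single_dotProduct,
    Pi.single_eq_of_ne h]
  decide

theorem sum_elim_dotProduct {α β : Type} [Fintype α] [Fintype β] (a a' : α → ZMod 2)
    (b b' : β → ZMod 2) : Sum.elim a b ⬝ᵥ Sum.elim a' b' = a ⬝ᵥ a' + b ⬝ᵥ b' :=
  Fintype.sum_sum_type _

end BinaryCode

namespace HyperbolicFrame

/-- A frame on two copies of a set with `m + 2` elements, built from the doubly-even code of
the words `(x, x)`, with `x` of even weight, and `(1, 0)`. -/
def standard (m : ℕ) (hm : 4 ∣ m + 2) :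
    HyperbolicFrame (Option (Option (Fin m)) ⊕ Option (Option (Fin m))) (WithBot (Fin m)) where
  -- The coordinate `none` makes the halves of each `d j` even, and the different coordinate `some
  -- none` does this for `g j`; keeping them apart leaves `d j` and `g l` dual.
  d := WithBot.recBotCoe (Sum.elim 1 0) fun j =>
    Sum.elim (Pi.single (some (some j)) 1 + Pi.single none 1)
      (Pi.single (some (some j)) 1 + Pi.single none 1)
  g := WithBot.recBotCoe (Sum.elim (Pi.single none 1) (Pi.single none 1)) fun j =>
    Sum.elim 0 (Pi.single (some (some j)) 1 + Pi.single (some none) 1)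
  four_dvd_d i := by
    induction i using WithBot.recBotCoe with
    | bot =>
      simp only [WithBot.recBotCoe_bot]
      rw [BinaryCode.hammingNorm_sum_elim, BinaryCode.hammingNorm_one, hammingNorm_zero]
      simpa using hm
    | coe j =>
      simp only [WithBot.recBotCoe_coe]
      rw [BinaryCode.hammingNorm_sum_elim, BinaryCode.four_dvd_iff, Nat.cast_add,
        BinaryCode.hammingNorm_single_add_single (by simp)]
      decide
  d_dot_d i j := by
    have h : ((m + 2 : ℕ) : ZMod 2) = 0 :=
      (ZMod.natCast_eq_zero_iff _ _).2 ((by norm_num : 2 ∣ 4).trans hm)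
    induction i using WithBot.recBotCoe <;> induction j using WithBot.recBotCoe <;>
      simp only [WithBot.recBotCoe_bot, WithBot.recBotCoe_coe, BinaryCode.sum_elim_dotProduct,
        CharTwo.add_self_eq_zero]
    · rw [BinaryCode.dotProduct_one_eq, BinaryCode.hammingNorm_one, dotProduct_zero, add_zero, ← h]
      simp [add_assoc, one_add_one_eq_two]
    · simp [CharTwo.add_self_eq_zero]
    · simp [CharTwo.add_self_eq_zero]
  d_dot_g i j := by
    induction i using WithBot.recBotCoe <;> induction j using WithBot.recBotCoe <;>
      simp only [WithBot.recBotCoe_bot, WithBot.recBotCoe_coe, BinaryCode.sum_elim_dotProduct,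
        CharTwo.add_self_eq_zero]
    · simp
    · simp
    · simp
    · simp [Pi.single_apply, eq_comm]
  g_weight i := by
    induction i using WithBot.recBotCoe with
    | bot =>
      simp only [WithBot.recBotCoe_bot]
      rw [BinaryCode.hammingNorm_sum_elim, BinaryCode.hammingNorm_single]
      decide
    | coe j =>
      simp only [WithBot.recBotCoe_coe]
      rw [BinaryCode.hammingNorm_sum_elim, Nat.cast_add,
        BinaryCode.hammingNorm_single_add_single (by simp), hammingNorm_zero]
      decide

end HyperbolicFrame

/-! ### Existence of good self-dual doubly-even codes -/

namespace BinaryCode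

/-- A Gilbert–Varshamov bound for self-dual doubly-even codes. -/
theorem exists_isSelfDual_isDoublyEven_minDist (i : ℕ) :
    ∃ C : BinaryCode (Fin (48 * (i + 1))), C.IsSelfDual ∧ C.IsDoublyEven ∧
      C.dim = 24 * (i + 1) ∧ 3 * (i + 1) < C.minDist := by
  have hm : 24 * i + 22 + 2 = 24 * (i + 1) := by ring
  -- The frame has n/2 - 1 pairs for n = 48(i+1); the all-ones word supplies the last dimension.
  have hκ : Fintype.card (WithBot (Fin (24 * i + 22))) = 24 * i + 23 := by
    rw [← Nat.card_eq_fintype_card]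
    exact (Nat.card_congr (Equiv.refl (Option (Fin (24 * i + 22))))).trans (by simp)
  obtain ⟨F⟩ : Nonempty (HyperbolicFrame (Fin (48 * (i + 1))) (WithBot (Fin (24 * i + 22)))) :=
    ⟨(HyperbolicFrame.standard (24 * i + 22) (by omega)).reindex
      (Fintype.equivOfCardEq (by simp; omega))⟩
  have hcount : (Finset.univ.filter fun v : Fin (48 * (i + 1)) → ZMod 2 =>
      hammingNorm v ≤ 3 * (i + 1)).card < 2 ^ (Fintype.card (WithBot (Fin (24 * i + 22))) - 1) := by
    have h := card_hammingNorm_le_mul (ι := Fin (48 * (i + 1))) (w := 3 * (i + 1))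
      (by rw [Fintype.card_fin]; omega)
    rw [Fintype.card_fin] at h
    rw [hκ]
    refine lt_of_mul_lt_mul_right (h.trans_lt ?_) (Nat.zero_le _)
    have e1 : 48 * (i + 1) - 3 * (i + 1) = 45 * (i + 1) := by omega
    have e2 : (4 : ℕ) ^ (45 * (i + 1)) = 2 ^ (90 * (i + 1)) := by
      rw [show (4 : ℕ) = 2 ^ 2 by norm_num, ← pow_mul]
      congr 1
      ring
    rw [e1, e2, ← pow_add]
    -- With N = i+1, the ball has at most 5^(48N)/2^(90N) < 2^(22N) words because 5^48 < 2^112, and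
    -- 22N ≤ 24N - 2, the available exponent.
    calc 5 ^ (48 * (i + 1)) = (5 ^ 48) ^ (i + 1) := pow_mul _ _ _
      _ < (2 ^ 112) ^ (i + 1) := Nat.pow_lt_pow_left (by norm_num) (by omega)
      _ = 2 ^ (112 * (i + 1)) := (pow_mul _ _ _).symm
      _ ≤ _ := Nat.pow_le_pow_right (by norm_num) (by omega)
  obtain ⟨M, hM⟩ := F.exists_code_weight_gt (by rw [Fintype.card_fin]; omega) hcount
  have hdim : (F.code M).dim = 24 * (i + 1) := by
    have : Nonempty (Fin (48 * (i + 1))) := ⟨⟨0, by omega⟩⟩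
    rw [F.dim_code, hκ]
    omega
  refine ⟨F.code M, F.isSelfDual_code M ?_ ?_, F.isDoublyEven_code M ?_, hdim, ?_⟩
  · rw [Fintype.card_fin]; omega
  · rw [hκ, Fintype.card_fin]; omega
  · rw [Fintype.card_fin]; omega
  · refine le_minDist ?_ hM
    intro h
    rw [h, dim, finrank_bot] at hdim
    omega

end BinaryCode

/-! ### Dimension and distance of the punctured, shortened and repeated codes -/

namespace BinaryCode

section Spread

variable {ι : Type}

/-- Delete the coordinates in `T`, then repeat the word `r` times. -/
def spread (T : Finset ι) (r : ℕ) :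
    (ι → ZMod 2) →ₗ[ZMod 2] (Fin r × {j : ι // j ∉ T} → ZMod 2) :=
  LinearMap.funLeft (ZMod 2) (ZMod 2) Prod.snd ∘ₗ deleteCoords T

theorem spread_apply (T : Finset ι) (r : ℕ) (x : ι → ZMod 2) (k : Fin r × {j : ι // j ∉ T}) :
    spread T r x k = x k.2 := rfl

theorem ofPuncture_C₁ (C : BinaryCode ι) (T : Finset ι) (p : ℕ) :
    (CSSCode.ofPuncture C T p).C₁ = C.map (spread T (2 ^ p)) :=
  (Submodule.map_comp _ _ _).symm

theorem ofPuncture_C₂ (C : BinaryCode ι) (T : Finset ι) (p : ℕ) :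
    (CSSCode.ofPuncture C T p).C₂ = (C ⊓ vanishingOn T).map (spread T (2 ^ p)) :=
  (Submodule.map_comp _ _ _).symm

theorem hammingNorm_restrict_le (T : Finset ι) (x : ι → ZMod 2) :
    hammingNorm (fun t : {t // t ∈ T} => x t) ≤ T.card :=
  hammingNorm_le_card_fintype.trans (Fintype.card_coe T).le

variable [Fintype ι] [DecidableEq ι]

theorem sum_eq_add_sum {R : Type} [AddCommMonoid R] (T : Finset ι) (f : ι → R) :
    ∑ i, f i = ∑ t : {t // t ∈ T}, f t + ∑ j : {j // j ∉ T}, f j := by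
  rw [← Fintype.sum_subtype_add_sum_subtype (· ∈ T) f]
  congr 1
  refine Finset.sum_congr ?_ fun _ _ => rfl
  ext
  simp

theorem hammingNorm_eq_add (T : Finset ι) (x : ι → ZMod 2) :
    hammingNorm x = hammingNorm (fun t : {t // t ∈ T} => x t) +
      hammingNorm (fun j : {j // j ∉ T} => x j) := by
  simp only [hammingNorm_eq_sum_val]
  exact sum_eq_add_sum T fun i => (x i).val

theorem hammingNorm_spread (T : Finset ι) (r : ℕ) (x : ι → ZMod 2) :
    hammingNorm (spread T r x) = r * hammingNorm (fun j : {j // j ∉ T} => x j) := by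
  simp only [hammingNorm_eq_sum_val, Fintype.sum_prod_type, spread_apply]
  simp

theorem minDist_sub_le {C : BinaryCode ι} (T : Finset ι) {x : ι → ZMod 2} (hx : x ∈ C)
    (hx0 : x ≠ 0) :
    C.minDist - T.card ≤ hammingNorm (fun j : {j // j ∉ T} => x j) := by
  have h1 := minDist_le hx hx0
  have h2 := hammingNorm_eq_add T x
  have h3 := hammingNorm_restrict_le T x
  omega

/-- A word lost by the deletion is supported on `T`, too small to carry a nonzero codeword. This
makes `spread` injective on `C`. -/
theorem eq_zero_of_spread_eq_zero {C : BinaryCode ι} {T : Finset ι} (hT : T.card < C.minDist)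
    {r : ℕ} (hr : 0 < r) {x : ι → ZMod 2} (hx : x ∈ C) (h : spread T r x = 0) : x = 0 := by
  by_contra hx0
  have h1 := minDist_sub_le T hx hx0
  have h2 : (fun j : {j // j ∉ T} => x j) = 0 := funext fun j => congrFun h (⟨0, hr⟩, j)
  rw [h2, hammingNorm_zero] at h1
  omega

/-- Fewer than `d(C)` coordinates of a self-dual code form part of an information set. -/
theorem IsSelfDual.exists_systematic {C : BinaryCode ι} (hC : C.IsSelfDual) {T : Finset ι}
    (hT : T.card < C.minDist) :
    ∃ c : {t // t ∈ T} → ι → ZMod 2, (∀ t, c t ∈ C) ∧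
      ∀ t t' : {t // t ∈ T}, c t t' = if t = t' then 1 else 0 := by
  let ρ : (ι → ZMod 2) →ₗ[ZMod 2] ({t // t ∈ T} → ZMod 2) :=
    LinearMap.funLeft (ZMod 2) (ZMod 2) Subtype.val
  have htop : C.map ρ = ⊤ := by
    -- A word orthogonal to the restriction of `C` to `T`, extended by zero, lies in the dual, that
    -- is in `C`; its weight is below the minimum distance.
    have hdual : BinaryCode.dual (C.map ρ) = ⊥ := by
      rw [eq_bot_iff]
      intro z hz
      let z' : ι → ZMod 2 := fun i => if h : i ∈ T then z ⟨i, h⟩ else 0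
      have hz'T : (fun t : {t // t ∈ T} => z' t) = z := by
        ext t
        simp [z']
      have hz'C : z' ∈ C := by
        rw [← hC]
        intro x hx
        rw [sum_eq_add_sum T fun i => z' i * x i]
        have h1 : ∑ i : {i // i ∉ T}, z' i * x i = 0 :=
          Finset.sum_eq_zero fun i _ => by simp [z', i.2]
        rw [h1, add_zero]
        have h2 := hz (ρ x) ⟨x, hx, rfl⟩
        rw [← hz'T] at h2
        exact h2
      have h0 : z' = 0 := by
        refine eq_zero_of_spread_eq_zero hT zero_lt_one hz'C ?_
        ext k
        simp [spread_apply, z', k.2.2]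
      rw [Submodule.mem_bot, ← hz'T, h0]
      rfl
    rw [← dual_dual (C.map ρ), hdual, eq_top_iff]
    intro x _
    rw [mem_dual]
    rintro y hy
    rw [(Submodule.mem_bot _).1 hy, dotProduct_zero]
  have hex : ∀ t : {t // t ∈ T}, ∃ x ∈ C, ρ x = Pi.single t 1 := fun t => by
    have : (Pi.single t 1 : {t // t ∈ T} → ZMod 2) ∈ C.map ρ := htop ▸ Submodule.mem_top
    exact this
  choose c hc hc' using hex
  refine ⟨c, hc, fun t t' => ?_⟩
  have := congrFun (hc' t) t'
  rw [Pi.single_apply] at this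
  simpa [eq_comm, ρ] using this

omit [Fintype ι] in
theorem sub_sum_mem_vanishingOn {C : BinaryCode ι} {T : Finset ι}
    {c : {t // t ∈ T} → ι → ZMod 2} (hc : ∀ t, c t ∈ C)
    (hc' : ∀ t t' : {t // t ∈ T}, c t t' = if t = t' then 1 else 0) {x : ι → ZMod 2}
    (hx : x ∈ C) : x - ∑ t : {t // t ∈ T}, x t • c t ∈ C ⊓ vanishingOn T := by
  refine ⟨C.sub_mem hx (C.sum_mem fun t _ => C.smul_mem _ (hc t)), fun j hj => ?_⟩
  have h : ∀ t : {t // t ∈ T}, c t j = if t = ⟨j, hj⟩ then 1 else 0 := fun t => hc' t ⟨j, hj⟩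
  simp [h]

theorem finrank_map_spread {C W : BinaryCode ι} (hW : W ≤ C) {T : Finset ι}
    (hT : T.card < C.minDist) {r : ℕ} (hr : 0 < r) :
    BinaryCode.dim (W.map (spread T r)) = W.dim := by
  have hinj : Function.Injective ((spread T r).domRestrict W) := by
    rw [injective_iff_map_eq_zero]
    intro x hx
    exact Subtype.ext (eq_zero_of_spread_eq_zero hT hr (hW x.2) hx)
  have h := LinearMap.finrank_range_of_inj hinj
  rw [LinearMap.range_domRestrict] at h
  exact h

/-- Rank-nullity for the restriction of `C` to `T`, which is onto by `exists_systematic`. -/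
theorem dim_inf_vanishingOn_add_card {C : BinaryCode ι} (hC : C.IsSelfDual) {T : Finset ι}
    (hT : T.card < C.minDist) : T.card + BinaryCode.dim (C ⊓ vanishingOn T) = C.dim := by
  obtain ⟨c, hc, hc'⟩ := hC.exists_systematic hT
  let ρ : C →ₗ[ZMod 2] ({t // t ∈ T} → ZMod 2) :=
    (LinearMap.funLeft (ZMod 2) (ZMod 2) Subtype.val).domRestrict C
  have hρ : Function.Surjective ρ := by
    intro a
    refine ⟨⟨∑ t, a t • c t, C.sum_mem fun t _ => C.smul_mem _ (hc t)⟩, ?_⟩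
    ext t
    simp [ρ, LinearMap.funLeft_apply, hc']
  have hker : (LinearMap.ker ρ).map C.subtype = C ⊓ vanishingOn T := by
    ext x
    simp only [Submodule.mem_map, LinearMap.mem_ker, Submodule.mem_inf]
    constructor
    · rintro ⟨y, hy, rfl⟩
      exact ⟨y.2, fun j hj => congrFun hy ⟨j, hj⟩⟩
    · rintro ⟨hx, hxT⟩
      exact ⟨⟨x, hx⟩, funext fun t => hxT t t.2, rfl⟩
  have h := LinearMap.finrank_range_add_finrank_ker ρ
  rw [LinearMap.range_eq_top.2 hρ, finrank_top, Module.finrank_fintype_fun_eq_card,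
    Fintype.card_coe, ← Submodule.finrank_map_subtype_eq, hker] at h
  exact h

theorem logicalQubits_ofPuncture {C : BinaryCode ι} (hC : C.IsSelfDual) {T : Finset ι}
    (hT : T.card < C.minDist) (p : ℕ) :
    (CSSCode.ofPuncture C T p).logicalQubits = T.card := by
  rw [CSSCode.logicalQubits, ofPuncture_C₁, ofPuncture_C₂,
    finrank_map_spread le_rfl hT (by positivity), finrank_map_spread inf_le_left hT (by positivity),
    ← dim_inf_vanishingOn_add_card hC hT, Nat.add_sub_cancel]

theorem spread_mem_C₂_iff {C : BinaryCode ι} {T : Finset ι} (hT : T.card < C.minDist) (p : ℕ)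
    {x : ι → ZMod 2} (hx : x ∈ C) :
    spread T (2 ^ p) x ∈ (CSSCode.ofPuncture C T p).C₂ ↔ x ∈ vanishingOn T := by
  rw [ofPuncture_C₂]
  refine ⟨?_, fun h => ⟨x, ⟨hx, h⟩, rfl⟩⟩
  rintro ⟨y, ⟨hyC, hyT⟩, hy⟩
  have h : x - y = 0 := by
    refine eq_zero_of_spread_eq_zero hT (r := 2 ^ p) (by positivity) (C.sub_mem hx hyC) ?_
    rw [map_sub, hy, sub_self]
  rwa [sub_eq_zero.1 h]

/-- The word of column sums of a word on `r` copies, extended by zero on `T`. -/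
def columnSum (T : Finset ι) (r : ℕ) (z : Fin r × {j : ι // j ∉ T} → ZMod 2) : ι → ZMod 2 :=
  fun i => if h : i ∈ T then 0 else ∑ s, z (s, ⟨i, h⟩)

/-- `columnSum` is the adjoint of `spread`; it brings the duals of the repeated codes back to the
original coordinates. -/
theorem dotProduct_spread (T : Finset ι) (r : ℕ) (z : Fin r × {j : ι // j ∉ T} → ZMod 2)
    (x : ι → ZMod 2) : z ⬝ᵥ spread T r x = columnSum T r z ⬝ᵥ x := by
  have h1 : ∑ i : {i // i ∈ T}, columnSum T r z i * x i = 0 :=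
    Finset.sum_eq_zero fun i _ => by simp [columnSum, i.2]
  have h2 : columnSum T r z ⬝ᵥ x = _ :=
    sum_eq_add_sum T fun i => columnSum T r z i * x i
  rw [h2, h1, zero_add, dotProduct, Fintype.sum_prod_type_right]
  refine Finset.sum_congr rfl fun j _ => ?_
  rw [columnSum, dif_neg j.2, Finset.sum_mul]
  rfl

theorem hammingNorm_columnSum_le (T : Finset ι) (r : ℕ)
    (z : Fin r × {j : ι // j ∉ T} → ZMod 2) :
    hammingNorm (columnSum T r z) ≤ hammingNorm z := by
  refine (Finset.card_le_card (t := (Finset.univ.filter fun k => z k ≠ 0).image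
    fun k => (k.2 : ι)) ?_).trans Finset.card_image_le
  intro i hi
  have hi' := (Finset.mem_filter.1 hi).2
  rw [columnSum] at hi'
  split_ifs at hi' with h
  · exact absurd rfl hi'
  · obtain ⟨s, -, hs⟩ := Finset.exists_ne_zero_of_sum_ne_zero hi'
    exact Finset.mem_image.2 ⟨(s, ⟨i, h⟩), by simpa using hs, rfl⟩

theorem minDist_sub_le_hammingNorm_of_mem_dual {C : BinaryCode ι} (hC : C.IsSelfDual)
    {T : Finset ι} (hT : T.card < C.minDist) {p : ℕ}
    {z : Fin (2 ^ p) × {j : ι // j ∉ T} → ZMod 2}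
    (hz₂ : z ∈ (CSSCode.ofPuncture C T p).C₂.dual)
    (hz₁ : z ∉ (CSSCode.ofPuncture C T p).C₁.dual) :
    C.minDist - T.card ≤ hammingNorm z := by
  obtain ⟨c, hc, hc'⟩ := hC.exists_systematic hT
  set s := columnSum T (2 ^ p) z with hs
  -- `u` lives on `T` and is chosen so that `s - u` pairs with `x ∈ C` as `s` pairs with `x - ∑ x t
  -- • c t`, a word of `C` vanishing on `T`. That pairing is zero since `z` is orthogonal to `C₂`.
  let u : ι → ZMod 2 := fun i => if h : i ∈ T then s ⬝ᵥ c ⟨i, h⟩ else 0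
  have hu : ∀ x : ι → ZMod 2, u ⬝ᵥ x = ∑ t : {t // t ∈ T}, (s ⬝ᵥ c t) * x t := by
    intro x
    have h1 : ∑ i : {i // i ∉ T}, u i * x i = 0 :=
      Finset.sum_eq_zero fun i _ => by simp [u, i.2]
    have h2 : u ⬝ᵥ x = _ :=
      sum_eq_add_sum T fun i => u i * x i
    rw [h2, h1, add_zero]
    exact Finset.sum_congr rfl fun t _ => by simp [u]
  have hmem : s - u ∈ C := by
    rw [← hC, mem_dual]
    intro x hx
    have h := mem_dual.1 hz₂ (spread T (2 ^ p) (x - ∑ t : {t // t ∈ T}, x t • c t))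
      (by rw [ofPuncture_C₂]; exact ⟨_, sub_sum_mem_vanishingOn hc hc' hx, rfl⟩)
    rw [dotProduct_spread, ← hs, dotProduct_sub, dotProduct_sum] at h
    rw [sub_dotProduct, hu, ← h]
    congr 1
    refine Finset.sum_congr rfl fun t _ => ?_
    rw [dotProduct_smul, smul_eq_mul, mul_comm]
  have hoff : ∀ j : {j // j ∉ T}, (s - u) j = s j := fun j => by simp [u, j.2]
  have hne : s - u ≠ 0 := by
    intro h0
    -- If `s = u`, then `s` vanishes off `T`, and on `T` by construction; but `s = 0` puts `z` in
    -- `C₁.dual`.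
    have hs0 : s = 0 := by
      ext i
      by_cases hi : i ∈ T
      · simp [hs, columnSum, hi]
      · rw [← hoff ⟨i, hi⟩, h0]
    refine hz₁ (mem_dual.2 ?_)
    rw [ofPuncture_C₁]
    rintro _ ⟨x, -, rfl⟩
    rw [dotProduct_spread, ← hs, hs0, zero_dotProduct]
  have h1 := minDist_sub_le T hmem hne
  simp only [hoff] at h1
  have h2 := hammingNorm_eq_add T s
  have h3 := hammingNorm_columnSum_le T (2 ^ p) z
  rw [← hs] at h3
  omega

theorem minDist_sub_le_minDist_ofPuncture {C : BinaryCode ι} (hC : C.IsSelfDual)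
    {T : Finset ι} (hT : T.card < C.minDist) (hT0 : T.Nonempty) (p : ℕ) :
    C.minDist - T.card ≤ (CSSCode.ofPuncture C T p).minDist := by
  refine le_csInf ?_ ?_
  -- The infimum of the empty set is 0, so a word of `C₁` outside `C₂` must be exhibited; this is
  -- where `T` must be nonempty.
  · obtain ⟨c, hc, hc'⟩ := hC.exists_systematic hT
    obtain ⟨t, ht⟩ := hT0
    refine ⟨_, spread T (2 ^ p) (c ⟨t, ht⟩), Or.inl ⟨?_, ?_⟩, rfl⟩
    · rw [ofPuncture_C₁]
      exact ⟨_, hc _, rfl⟩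
    · rw [spread_mem_C₂_iff hT p (hc _)]
      intro h
      have h1 := hc' ⟨t, ht⟩ ⟨t, ht⟩
      rw [h t ht, if_pos rfl] at h1
      exact zero_ne_one h1
  · rintro _ ⟨z, ⟨hz₁, hz₂⟩ | ⟨hz₂, hz₁⟩, rfl⟩
    · rw [ofPuncture_C₁] at hz₁
      obtain ⟨x, hx, rfl⟩ := hz₁
      have hx0 : x ≠ 0 := by
        rintro rfl
        exact hz₂ (by rw [map_zero]; exact Submodule.zero_mem _)
      rw [hammingNorm_spread]
      exact (minDist_sub_le T hx hx0).trans (Nat.le_mul_of_pos_left _ (by positivity))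
    · exact minDist_sub_le_hammingNorm_of_mem_dual hC hT hz₂ hz₁

end Spread

end BinaryCode

/-! ### Diagonal transversal gates -/

section Gates

variable {ι : Type} [Fintype ι] [DecidableEq ι]

theorem transversal_diagonal_mulVec (m : ZMod 2 → ℂ) (ψ : (ι → ZMod 2) → ℂ) (v : ι → ZMod 2) :
    (transversal ι (Matrix.diagonal m)).mulVec ψ v = (∏ i, m (v i)) * ψ v := by
  have h : transversal ι (Matrix.diagonal m) = Matrix.diagonal fun v => ∏ i, m (v i) := by
    ext v w
    simp only [transversal, kron, Matrix.of_apply]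
    by_cases hvw : v = w
    · subst hvw
      simp
    · obtain ⟨i, hi⟩ := Function.ne_iff.1 hvw
      rw [Matrix.diagonal_apply_ne _ hvw]
      exact Finset.prod_eq_zero (Finset.mem_univ i) (Matrix.diagonal_apply_ne _ hi)
  rw [h, Matrix.mulVec_diagonal]

omit [DecidableEq ι] in
theorem prod_phase (ω : ℂ) (v : ι → ZMod 2) :
    ∏ i, (if v i = 0 then 1 else ω) = ω ^ hammingNorm v := by
  rw [Finset.prod_ite, Finset.prod_const_one, one_mul, Finset.prod_const]
  rfl

theorem rotZ_mulVec (θ : ℝ) (ψ : (ι → ZMod 2) → ℂ) (v : ι → ZMod 2) :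
    (transversal ι (rotZ θ)).mulVec ψ v =
      Complex.exp (Complex.I * (θ : ℂ)) ^ hammingNorm v * ψ v := by
  rw [rotZ, transversal_diagonal_mulVec, prod_phase]

theorem gateS_conjTranspose_mulVec (ψ : (ι → ZMod 2) → ℂ) (v : ι → ZMod 2) :
    (transversal ι gateS.conjTranspose).mulVec ψ v = (-Complex.I) ^ hammingNorm v * ψ v := by
  have h : gateS.conjTranspose = Matrix.diagonal fun b => if b = 0 then 1 else -Complex.I := by
    rw [gateS, Matrix.diagonal_conjTranspose]
    congr 1
    ext b
    by_cases hb : b = 0 <;> simp [hb]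
  rw [h, transversal_diagonal_mulVec, prod_phase]

theorem pauliE_left_mulVec (x : ι → ZMod 2) (ψ : (ι → ZMod 2) → ℂ) (v : ι → ZMod 2) :
    (pauliE x 0).mulVec ψ v = ψ (v + x) := by
  have key : ∀ a b c : ZMod 2, (Complex.I ^ (a.val * (0 : ZMod 2).val) •
      (pauliX ^ a.val * pauliZ ^ (0 : ZMod 2).val)) b c = if c = b + a then 1 else 0 := by
    intro a b c
    have hbc : (b = c) ↔ ¬ c = b + 1 := by decide +revert
    rcases (by decide +revert : a = 0 ∨ a = 1) with rfl | rfl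
    · simp [Matrix.one_apply, eq_comm]
    · by_cases h : c = b + 1 <;> simp [pauliX, ZMod.val_one, hbc, h]
  have h : ∀ w, pauliE x 0 v w = if w = v + x then 1 else 0 := by
    intro w
    simp only [pauliE, kron, Matrix.of_apply, Pi.zero_apply, key]
    split_ifs with hw
    · exact Finset.prod_eq_one fun i _ => if_pos (congrFun hw i)
    · obtain ⟨i, hi⟩ := Function.ne_iff.1 hw
      exact Finset.prod_eq_zero (Finset.mem_univ i) (if_neg hi)
  simp [Matrix.mulVec, dotProduct, h]

omit [DecidableEq ι] in
theorem prod_sign (f : ι → ZMod 2) :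
    ∏ i, (if f i = 0 then (1 : ℂ) else -1) = if ∑ i, f i = 0 then 1 else -1 := by
  let χ : Multiplicative (ZMod 2) →* ℂ :=
    { toFun := fun a => if a.toAdd = 0 then 1 else -1
      map_one' := rfl
      map_mul' := by
        intro a b
        -- Decided over ℤ, where equality is computable, and then cast to ℂ.
        have key : ∀ a b : ZMod 2, (if a + b = 0 then (1 : ℤ) else -1) =
          (if a = 0 then 1 else -1) * (if b = 0 then 1 else -1) := by decide
        have h := congrArg (Int.cast : ℤ → ℂ) (key a.toAdd b.toAdd)
        push_cast at h
        exact h }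
  have h := map_prod χ (fun i => Multiplicative.ofAdd (f i)) Finset.univ
  rw [← ofAdd_sum] at h
  exact h.symm

theorem pauliE_right_mulVec (z : ι → ZMod 2) (ψ : (ι → ZMod 2) → ℂ) (v : ι → ZMod 2) :
    (pauliE 0 z).mulVec ψ v = (if z ⬝ᵥ v = 0 then 1 else -1) * ψ v := by
  have key : ∀ a b c : ZMod 2, (Complex.I ^ ((0 : ZMod 2).val * a.val) •
      (pauliX ^ (0 : ZMod 2).val * pauliZ ^ a.val)) b c =
        if b = c then (if a * b = 0 then 1 else -1) else 0 := by
    intro a b c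
    rcases (by decide +revert : a = 0 ∨ a = 1) with rfl | rfl
    · simp [Matrix.one_apply]
    · simp [pauliZ, ZMod.val_one, Matrix.diagonal_apply]
  have h : ∀ w, pauliE 0 z v w = if v = w then (if z ⬝ᵥ v = 0 then 1 else -1) else 0 := by
    intro w
    simp only [pauliE, kron, Matrix.of_apply, Pi.zero_apply, key]
    by_cases hw : v = w
    · subst hw
      simp only [if_true]
      exact prod_sign fun i => z i * v i
    · rw [if_neg hw]
      obtain ⟨i, hi⟩ := Function.ne_iff.1 hw
      exact Finset.prod_eq_zero (Finset.mem_univ i) (if_neg hi)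
  simp [Matrix.mulVec, dotProduct, h]

/-- The code space consists of the functions on `C₁` that are constant on cosets of `C₂`. -/
theorem CSSCode.mem_codeSpace_iff (Q : CSSCode ι) {ψ : (ι → ZMod 2) → ℂ} :
    ψ ∈ Q.codeSpace ↔ (∀ x ∈ Q.C₂, ∀ v, ψ (v + x) = ψ v) ∧ ∀ v ∉ Q.C₁, ψ v = 0 := by
  refine and_congr ?_ ⟨fun h v hv => ?_, fun h z hz => ?_⟩
  · refine forall₂_congr fun x _ => ?_
    rw [funext_iff]
    exact forall_congr' fun v => by rw [pauliE_left_mulVec]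
  -- By biduality some Z-stabilizer has sign -1 at a point outside `C₁`, which forces `ψ v = -ψ v`.
  · rw [← BinaryCode.dual_dual Q.C₁, BinaryCode.mem_dual] at hv
    push Not at hv
    obtain ⟨z, hz, hzv⟩ := hv
    have e := congrFun (h z hz) v
    rw [pauliE_right_mulVec, dotProduct_comm, if_neg hzv] at e
    linear_combination (-1 / 2 : ℂ) * e
  · ext v
    rw [pauliE_right_mulVec]
    by_cases hv : v ∈ Q.C₁
    · rw [if_pos (BinaryCode.mem_dual.1 hz v hv), one_mul]
    · rw [h v hv, mul_zero]

end Gates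

/-! ### The logical action of the transversal rotation -/

namespace BinaryCode

variable {ι : Type} [Fintype ι] [DecidableEq ι]

theorem rotZ_phase_spread {C : BinaryCode ι} (hC : C.IsDoublyEven) (T : Finset ι) {l : ℕ}
    (hl : 1 ≤ l) {x : ι → ZMod 2} (hx : x ∈ C) :
    Complex.exp (Complex.I * ((Real.pi / 2 ^ l : ℝ) : ℂ)) ^
        hammingNorm (spread T (2 ^ (l - 1)) x) =
      (-Complex.I) ^ hammingNorm (fun t : {t // t ∈ T} => x t) := by
  obtain ⟨p, rfl⟩ := Nat.exists_eq_add_of_le' hl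
  rw [Nat.add_sub_cancel, hammingNorm_spread, pow_mul, ← Complex.exp_nat_mul]
  have h : ((2 ^ p : ℕ) : ℂ) * (Complex.I * ((Real.pi / 2 ^ (p + 1) : ℝ) : ℂ)) =
      Real.pi / 2 * Complex.I := by
    push_cast
    rw [pow_succ]
    field_simp
  rw [h, Complex.exp_pi_div_two_mul_I]
  obtain ⟨m, hm⟩ := hC x hx
  rw [hammingNorm_eq_add T] at hm
  -- After multiplication by i^(weight on `T`), the left side is i to the full weight, which is 1 as
  -- 4 divides it, and the right side is (i·(-i))^(weight on `T`) = 1.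
  refine mul_left_cancel₀ (pow_ne_zero (hammingNorm fun t : {t // t ∈ T} => x t)
    Complex.I_ne_zero) ?_
  rw [← pow_add, hm, pow_mul, Complex.I_pow_four, one_pow, ← mul_pow]
  simp

theorem realizesTransversal_ofPuncture {C : BinaryCode ι} (hC : C.IsSelfDual)
    (hC' : C.IsDoublyEven) {T : Finset ι} (hT : T.card < C.minDist) {l : ℕ} (hl : 1 ≤ l) :
    (CSSCode.ofPuncture C T (l - 1)).RealizesTransversal (rotZ (Real.pi / 2 ^ l))
      gateS.conjTranspose := by
  constructor
  · intro ψ hψ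
    rw [CSSCode.mem_codeSpace_iff] at hψ ⊢
    refine ⟨fun x hx v => ?_, fun v hv => ?_⟩
    · rw [rotZ_mulVec, rotZ_mulVec, hψ.1 x hx v]
      -- On `C₁`, adding a word that comes from `C ⊓ vanishingOn T` keeps the restriction to `T`,
      -- hence the phase; outside, `ψ` is zero.
      by_cases hv : v ∈ (CSSCode.ofPuncture C T (l - 1)).C₁
      · rw [ofPuncture_C₁] at hv
        rw [ofPuncture_C₂] at hx
        obtain ⟨a, ha, rfl⟩ := hv
        obtain ⟨b, ⟨hb, hbT⟩, rfl⟩ := hx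
        have h : (fun t : {t // t ∈ T} => (a + b) t) = fun t : {t // t ∈ T} => a t :=
          funext fun t => by simp [hbT t t.2]
        rw [← map_add, rotZ_phase_spread hC' T hl (C.add_mem ha hb),
          rotZ_phase_spread hC' T hl ha, h]
      · rw [hψ.2 v hv, mul_zero, mul_zero]
    · rw [rotZ_mulVec, hψ.2 v hv, mul_zero]
  · obtain ⟨c, hc, hc'⟩ := hC.exists_systematic hT
    set Q := CSSCode.ofPuncture C T (l - 1) with hQ
    have hk : Q.logicalQubits = T.card := logicalQubits_ofPuncture hC hT _
    have hC₁ : ∀ x ∈ C, spread T (2 ^ (l - 1)) x ∈ Q.C₁ := fun x hx => by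
      rw [hQ, ofPuncture_C₁]
      exact ⟨x, hx, rfl⟩
    let e : Fin Q.logicalQubits ≃ {t // t ∈ T} := Fintype.equivOfCardEq (by simp [hk])
    -- The systematic words serve as logical basis: up to the relabelling `e`, the restriction of `Y
    -- a` to `T` is `a`.
    let Y : (Fin Q.logicalQubits → ZMod 2) → ι → ZMod 2 := fun a => ∑ i, a i • c (e i)
    have hYC : ∀ a, Y a ∈ C := fun a => C.sum_mem fun i _ => C.smul_mem _ (hc _)
    have hYT : ∀ a (t : {t // t ∈ T}), Y a t = a (e.symm t) := by
      intro a t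
      have h : ∀ i, e i = t ↔ i = e.symm t := fun i => e.eq_symm_apply.symm
      simp [Y, hc', h]
    have hY : ∀ a, ∑ i, a i • spread T (2 ^ (l - 1)) (c (e i)) = spread T (2 ^ (l - 1)) (Y a) :=
      fun a => by simp [Y]
    refine ⟨fun i => spread T (2 ^ (l - 1)) (c (e i)), ⟨?_, ?_, ?_⟩, ?_⟩
    · exact fun i => hC₁ _ (hc _)
    · rw [Fintype.linearIndependent_iff]
      intro a ha i
      have h : Q.C₂.mkQ (∑ i, a i • spread T (2 ^ (l - 1)) (c (e i))) = 0 := by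
        rw [map_sum, ← ha]
        exact Finset.sum_congr rfl fun i _ => map_smul _ _ _
      rw [hY, Submodule.mkQ_apply, Submodule.Quotient.mk_eq_zero, hQ,
        spread_mem_C₂_iff hT _ (hYC a)] at h
      have h2 := h (e i) (e i).2
      rwa [hYT, Equiv.symm_apply_apply] at h2
    · refine le_antisymm (sup_le ?_ Q.le) ?_
      · rw [Submodule.span_le]
        rintro _ ⟨i, rfl⟩
        exact hC₁ _ (hc _)
      · nth_rewrite 1 [hQ]
        rw [ofPuncture_C₁]
        rintro _ ⟨x, hx, rfl⟩
        have h : x = ∑ t : {t // t ∈ T}, x t • c t + (x - ∑ t : {t // t ∈ T}, x t • c t) := by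
          rw [add_sub_cancel]
        rw [h, map_add]
        refine Submodule.add_mem_sup ?_ ?_
        · rw [map_sum]
          refine Submodule.sum_mem _ fun t _ => ?_
          rw [map_smul]
          exact Submodule.smul_mem _ _ (Submodule.subset_span ⟨e.symm t, by simp⟩)
        · rw [hQ, ofPuncture_C₂]
          exact ⟨_, sub_sum_mem_vanishingOn hc hc' hx, rfl⟩
    · intro φ
      ext v
      rw [rotZ_mulVec, CSSCode.encode, CSSCode.encode, Finset.sum_apply, Finset.sum_apply,
        Finset.mul_sum]
      refine Finset.sum_congr rfl fun a _ => ?_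
      rw [gateS_conjTranspose_mulVec, Pi.smul_apply, Pi.smul_apply, smul_eq_mul, smul_eq_mul]
      have key : Complex.exp (Complex.I * ((Real.pi / 2 ^ l : ℝ) : ℂ)) ^ hammingNorm v *
          Q.logicalKet (fun i => spread T (2 ^ (l - 1)) (c (e i))) a v =
          (-Complex.I) ^ hammingNorm a *
          Q.logicalKet (fun i => spread T (2 ^ (l - 1)) (c (e i))) a v := by
        simp only [CSSCode.logicalKet, Pi.smul_apply, Finset.sum_apply, smul_eq_mul]
        rw [mul_left_comm, mul_left_comm ((-Complex.I) ^ _)]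
        congr 1
        rw [Finset.mul_sum, Finset.mul_sum]
        refine Finset.sum_congr rfl fun x hx => ?_
        have hx : x ∈ Q.C₂ := by simpa using hx
        rw [hQ, ofPuncture_C₂] at hx
        obtain ⟨b, ⟨hb, hbT⟩, rfl⟩ := hx
        rw [hY, ← map_add]
        -- Only the ket at `v` itself contributes; there `Y a + b` restricts on `T` to `a`, so the
        -- phase depends on `a` alone.
        by_cases hv : v = spread T (2 ^ (l - 1)) (Y a + b)
        · rw [hv, rotZ_phase_spread hC' T hl (C.add_mem (hYC a) hb)]
          congr 2
          rw [hammingNorm_eq_sum_val, hammingNorm_eq_sum_val, ← e.symm.sum_comp]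
          refine Finset.sum_congr rfl fun t _ => ?_
          rw [Pi.add_apply, hYT, hbT t t.2, add_zero]
        · rw [ket, Pi.single_eq_of_ne hv, mul_zero, mul_zero]
      linear_combination φ a * key

end BinaryCode

/-! ### Asymptotic estimates and the conclusion -/

theorem asymptoticallyGoodParams_of_le {n k d : ℕ → ℕ} {δ : ℝ} (hδ : 0 < δ)
    (hn : Filter.Tendsto n Filter.atTop Filter.atTop)
    (hk : ∀ i, δ * n i ≤ k i) (hd : ∀ i, δ * n i ≤ d i)
    (hkn : ∀ i, k i ≤ n i) (hdn : ∀ i, d i ≤ n i) : AsymptoticallyGoodParams n k d := by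
  have key : ∀ a : ℕ → ℕ, (∀ i, δ * n i ≤ a i) → (∀ i, a i ≤ n i) →
      0 < Filter.liminf (fun i => (a i : ℝ) / (n i : ℝ)) Filter.atTop := by
    intro a h1 h2
    refine hδ.trans_le (Filter.le_liminf_of_le ?_ ?_)
    -- The real `liminf` is meaningful only for a cobounded sequence; the bound of the ratios by 1
    -- ensures this.
    · refine Filter.IsBoundedUnder.isCoboundedUnder_ge ⟨1, Filter.eventually_map.2 ?_⟩
      refine Filter.Eventually.of_forall fun i => div_le_one_of_le₀ ?_ (Nat.cast_nonneg _)
      exact_mod_cast h2 i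
    · filter_upwards [hn.eventually_gt_atTop 0] with i hi
      rw [le_div_iff₀ (by exact_mod_cast hi)]
      exact h1 i
  exact ⟨hn, key k hk hkn, key d hd hdn⟩

theorem BinaryCode.minDist_le_card {ι : Type} [Fintype ι] (C : BinaryCode ι) :
    C.minDist ≤ Fintype.card ι := by
  rcases Set.eq_empty_or_nonempty {w | ∃ x ∈ C, x ≠ 0 ∧ w = hammingNorm x} with h | h
  · rw [minDist, h, Nat.sInf_empty]
    exact Nat.zero_le _
  · obtain ⟨x, -, -, hx⟩ := Nat.sInf_mem h
    exact hx.le.trans hammingNorm_le_card_fintype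

theorem BinaryCode.dim_le_card {ι : Type} [Fintype ι] (C : BinaryCode ι) :
    C.dim ≤ Fintype.card ι :=
  (Submodule.finrank_le C).trans_eq (Module.finrank_fintype_fun_eq_card _)

theorem CSSCode.minDist_le_card {ι : Type} [Fintype ι] (Q : CSSCode ι) :
    Q.minDist ≤ Fintype.card ι := by
  rcases Set.eq_empty_or_nonempty {w | ∃ x : ι → ZMod 2,
    ((x ∈ Q.C₁ ∧ x ∉ Q.C₂) ∨ (x ∈ Q.C₂.dual ∧ x ∉ Q.C₁.dual)) ∧ w = hammingNorm x} with h | h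
  · rw [minDist, h, Nat.sInf_empty]
    exact Nat.zero_le _
  · obtain ⟨x, -, hx⟩ := Nat.sInf_mem h
    exact hx.le.trans hammingNorm_le_card_fintype

theorem lemma8 (l : ℕ) (hl : 1 ≤ l) :
    ∃ (n : ℕ → ℕ) (C : ∀ i, BinaryCode (Fin (n i))) (T : ∀ i, Finset (Fin (n i))),
      (∀ i, (C i).IsSelfDual ∧ (C i).IsDoublyEven) ∧
      BinaryCode.AsymptoticallyGood C ∧
      (∀ i, (T i).card = min (C i).dim (C i).minDist / 2) ∧
      CSSCode.AsymptoticallyGood (fun i => CSSCode.ofPuncture (C i) (T i) (l - 1)) ∧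
      ∀ i, (CSSCode.ofPuncture (C i) (T i) (l - 1)).RealizesTransversal
        (rotZ (Real.pi / 2 ^ l)) gateS.conjTranspose := by
  choose C hsd hde hdim hdist using BinaryCode.exists_isSelfDual_isDoublyEven_minDist
  have hT : ∀ i, ∃ T : Finset (Fin (48 * (i + 1))),
      T.card = min (C i).dim (C i).minDist / 2 := by
    intro i
    obtain ⟨T, -, hT⟩ := Finset.exists_subset_card_eq
      (s := (Finset.univ : Finset (Fin (48 * (i + 1))))) (n := min (C i).dim (C i).minDist / 2)
      (by rw [Finset.card_fin, hdim]; omega)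
    exact ⟨T, hT⟩
  choose T hT using hT
  have hTd : ∀ i, (T i).card < (C i).minDist := fun i => by
    have := hT i
    have := hdist i
    omega
  -- The distance is at least 3(i+1) + 1 and the dimension is 24(i+1), so half of the smaller,
  -- rounded down, is still at least i+1.
  have hTlow : ∀ i, i + 1 ≤ (T i).card := fun i => by
    have := hT i
    have := hdist i
    have := hdim i
    omega
  have hThigh : ∀ i, (T i).card ≤ 12 * (i + 1) := fun i => by
    have := hT i
    have := hdim i
    omega
  have hcard : ∀ i, Fintype.card (Fin (2 ^ (l - 1)) × {j : Fin (48 * (i + 1)) // j ∉ T i}) =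
      2 ^ (l - 1) * (48 * (i + 1) - (T i).card) := fun i => by
    rw [Fintype.card_prod, Fintype.card_fin, Fintype.card_subtype_compl, Fintype.card_fin,
      Fintype.card_coe]
  -- The CSS length is at most `2^(l-1)` · 48(i+1), while both the number of logical qubits and the
  -- distance are at least i+1; this fixes the constant.
  have hrate : ∀ i a : ℕ, i + 1 ≤ a → 1 / (48 * 2 ^ (l - 1)) *
      ((Fintype.card (Fin (2 ^ (l - 1)) × {j : Fin (48 * (i + 1)) // j ∉ T i}) : ℕ) : ℝ) ≤
        (a : ℝ) := by
    intro i a ha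
    have h1 : Fintype.card (Fin (2 ^ (l - 1)) × {j : Fin (48 * (i + 1)) // j ∉ T i}) ≤
        2 ^ (l - 1) * (48 * a) := by
      rw [hcard]
      exact Nat.mul_le_mul_left _ (by omega)
    rw [one_div, inv_mul_le_iff₀ (by positivity)]
    have h2 : ((Fintype.card (Fin (2 ^ (l - 1)) × {j : Fin (48 * (i + 1)) // j ∉ T i}) : ℕ) : ℝ) ≤
      ((2 ^ (l - 1) * (48 * a) : ℕ) : ℝ) := Nat.cast_le.2 h1
    push_cast at h2
    linarith
  refine ⟨fun i => 48 * (i + 1), C, T, fun i => ⟨hsd i, hde i⟩, ?_, hT, ?_, fun i =>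
    BinaryCode.realizesTransversal_ofPuncture (hsd i) (hde i) (hTd i) hl⟩
  -- 1/16 = 3/48 comes from the distance bound; the rate is 1/2.
  · refine asymptoticallyGoodParams_of_le (δ := 1 / 16) (by norm_num) ?_ (fun i => ?_)
      (fun i => ?_) (fun i => (C i).dim_le_card) (fun i => (C i).minDist_le_card)
    · refine Filter.tendsto_atTop_mono (fun i => ?_) Filter.tendsto_id
      rw [Fintype.card_fin]
      exact (by omega : i ≤ 48 * (i + 1))
    · rw [Fintype.card_fin, hdim]
      push_cast
      linarith [Nat.cast_nonneg (α := ℝ) i]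
    · rw [Fintype.card_fin]
      have h : ((3 * (i + 1) : ℕ) : ℝ) ≤ (C i).minDist := Nat.cast_le.2 (hdist i).le
      push_cast at h ⊢
      linarith
  · refine asymptoticallyGoodParams_of_le (δ := 1 / (48 * 2 ^ (l - 1))) (by positivity) ?_
      (fun i => hrate i _ ?_) (fun i => hrate i _ ?_)
      (fun i => (Nat.sub_le _ _).trans (BinaryCode.dim_le_card _))
      (fun i => CSSCode.minDist_le_card _)
    -- At most 12(i+1) of the 48(i+1) coordinates are deleted, so the length still grows.
    · refine Filter.tendsto_atTop_mono (fun i => ?_) Filter.tendsto_id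
      rw [hcard, id]
      have := hThigh i
      exact (by omega : i ≤ 48 * (i + 1) - (T i).card).trans
        (Nat.le_mul_of_pos_left _ (by positivity))
    · rw [BinaryCode.logicalQubits_ofPuncture (hsd i) (hTd i)]
      exact hTlow i
    · refine le_trans ?_ (BinaryCode.minDist_sub_le_minDist_ofPuncture (hsd i) (hTd i) ?_ _)
      · have := hT i
        have := hdist i
        omega
      · exact Finset.card_pos.1 (by have := hTlow i; omega)
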